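/- **Theorem.** There is an absolute constant $c>0$ such that the following holds. Let $P$ be a polyhedron in $\mathbb R^3$ (convex or not), that is, a closed connected surface made of finitely many simple planar polygons, its faces, glued along their sides. Let $f$ be a face of $P$, and let finitely many points in the relative interiors of edges of $P$ be chosen, at which the edges are subdivided. The skeleton of $P$ becomes a linkage whose joints are the vertices and the subdivision points, and whose rigid bars join consecutive joints on an edge. Suppose that this subdivided linkage can be turned inside-out through $f$, that is, there is a continuous motion of it over the time interval $[0,1]$, preserving the lengths of all bars, such that * it starts at $P$ and ends at the reflection of $P$ through some plane, and * it passes through $f$: every joint lies at some time $t$ in the convex hull of the position at time $t$ of the boundary curve of $f$. (The edges of $f$ may be subdivided too, so this curve may bend during the motion.) Then each edge $e$ of $P$ is subdivided at least $$c\,\log\frac{\operatorname{length}(e)}{\operatorname{dist}(e,f)+\operatorname{circumf}(f)/2}$$ times, i.e. it contains at least that many subdivision points. Here $\operatorname{dist}(e,f)$ is the length of a shortest path along edges of $P$ from a vertex of $f$ to an endpoint of $e$, and $\operatorname{circumf}(f)$ is the perimeter of $f$. The motion is not required to avoid crossings of bars; so the bound holds in particular for all motions that avoid crossings. -/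

import Mathlib

/-- Euclidean 3-space. -/
abbrev Space : Type := EuclideanSpace ℝ (Fin 3)

/-- A simple polygon in a plane of 3-space: a closed polygonal curve with `numSides ≥ 3` distinct
coplanar vertices, two different sides of which meet at most in a common endpoint.  The sides
join `vertices j` to the cyclically next vertex `vertices (finRotate _ j)`. -/
structure PlanarPolygon where
  numSides : ℕ
  poly : Polygon Space numSides
  three_le : 3 ≤ numSides
  injective : Function.Injective poly.vertices
  coplanar : Coplanar ℝ (Set.range poly.vertices)
  simple : ∀ j k : Fin numSides, j ≠ k →
    segment ℝ (poly j) (poly (finRotate _ j)) ∩ segment ℝ (poly k) (poly (finRotate _ k)) ⊆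
      ({poly j, poly (finRotate _ j)} ∩ {poly k, poly (finRotate _ k)} : Set Space)

namespace PlanarPolygon

/-- `x` is a corner of the polygon. -/
def IsVertex (F : PlanarPolygon) (x : Space) : Prop := ∃ j, F.poly j = x

/-- The unordered pair `a, b` is a side of the polygon. -/
def IsSide (F : PlanarPolygon) (a b : Space) : Prop :=
  ∃ j, (F.poly j = a ∧ F.poly (finRotate _ j) = b) ∨ (F.poly j = b ∧ F.poly (finRotate _ j) = a)

/-- The boundary curve: the union of the sides. -/
def boundary (F : PlanarPolygon) : Set Space :=
  ⋃ j, segment ℝ (F.poly j) (F.poly (finRotate _ j))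

/-- The closed region bounded by the polygon in its plane: the boundary curve together with the
points of the plane from which one cannot get to infinity in the plane without meeting that curve.
(For a point of the boundary itself, `connectedComponentIn` is empty, hence bounded.) -/
def region (F : PlanarPolygon) : Set Space :=
  let plane : Set Space := affineSpan ℝ (Set.range F.poly.vertices)
  {x ∈ plane | Bornology.IsBounded (connectedComponentIn (plane \ F.boundary) x)}

/-- The circumference (perimeter): the sum of the lengths of the sides. -/
noncomputable def circumference (F : PlanarPolygon) : ℝ :=
  ∑ j, dist (F.poly j) (F.poly (finRotate _ j))

end PlanarPolygon

/-- A polyhedron (convex or not): a finite collection of simple planar polygons, its faces, such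
that
* two faces meet only in common corners and along common sides;
* each side of a face is a side of exactly one other face;
* one can pass from each face to each other one across sides;
* around a corner, one can pass from each face at the corner to each other one across sides that
  end at the corner (so the surface is a closed surface near each corner). -/
structure Polyhedron where
  numFaces : ℕ
  face : Fin numFaces → PlanarPolygon
  inter_subset : ∀ i j, i ≠ j → ∀ x ∈ (face i).region ∩ (face j).region,
    ((face i).IsVertex x ∧ (face j).IsVertex x) ∨
      ∃ a b, (face i).IsSide a b ∧ (face j).IsSide a b ∧ x ∈ segment ℝ a b
  existsUnique_side : ∀ i a b, (face i).IsSide a b → ∃! j, j ≠ i ∧ (face j).IsSide a b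
  connected : ∀ i j,
    Relation.ReflTransGen (fun k l => ∃ a b, (face k).IsSide a b ∧ (face l).IsSide a b) i j
  connected_at_vertex : ∀ x i j, (face i).IsVertex x → (face j).IsVertex x →
    Relation.ReflTransGen (fun k l => ∃ b, (face k).IsSide x b ∧ (face l).IsSide x b) i j

/-- A linkage: a graph with an assignment of lengths to its edges
(`length x y` matters only for adjacent `x` and `y`). -/
structure Linkage (J : Type*) where
  graph : SimpleGraph J
  length : J → J → ℝ
  length_comm : ∀ x y, length x y = length y x

namespace Linkage

variable {J : Type*}

/-- A state (configuration) of a linkage places the joints in space, so that the straight bars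
between adjacent joints have the assigned lengths. -/
def IsState (L : Linkage J) (s : J → Space) : Prop :=
  ∀ x y, L.graph.Adj x y → dist (s x) (s y) = L.length x y

/-- A continuous motion of a linkage through states, over the time interval `[0, 1]`.  Bars may
touch, and nothing is required about how they do: the motions that avoid crossings, in whichever
model of touching bars, are among the motions considered here. -/
structure Motion (L : Linkage J) where
  state : unitInterval → J → Space
  isState : ∀ t, L.IsState (state t)
  continuous : ∀ x, Continuous fun t => state t x

end Linkage

namespace Polyhedron

/-- `x` is a vertex of the polyhedron. -/
def IsVertex (P : Polyhedron) (x : Space) : Prop := ∃ i, (P.face i).IsVertex x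

/-- The edge skeleton of the polyhedron, as a graph whose vertices are points of space (the points
that are not vertices of the polyhedron are isolated). -/
def skeleton (P : Polyhedron) : SimpleGraph Space where
  Adj a b := a ≠ b ∧ ∃ i, (P.face i).IsSide a b
  symm := ⟨fun _ _ h => ⟨h.1.symm, h.2.imp fun _ hi => hi.imp fun _ hj => hj.symm⟩⟩
  loopless := ⟨fun _ h => h.1 rfl⟩

/-- The Euclidean length of a path in the skeleton. -/
noncomputable def pathLength (P : Polyhedron) {x y : Space} (p : P.skeleton.Walk x y) : ℝ :=
  (p.darts.map fun d => dist d.fst d.snd).sum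

/-- The distance in the skeleton from the edge `a b` to the face `i`: the length of a shortest
path in the skeleton from a vertex of the face to an endpoint of the edge. -/
noncomputable def edgeFaceDist (P : Polyhedron) (a b : Space) (i : Fin P.numFaces) : ℝ :=
  sInf {l | ∃ w u, (P.face i).IsVertex w ∧ (u = a ∨ u = b) ∧
    ∃ p : P.skeleton.Walk w u, l = P.pathLength p}

/-- A finite subdivision of the edges of the polyhedron is given by the finite set of the points
at which the edges are divided, each of them in the relative interior of an edge. -/
def IsSubdivision (P : Polyhedron) (C : Finset Space) : Prop :=
  ∀ x ∈ C, ∃ a b, P.skeleton.Adj a b ∧ x ∈ openSegment ℝ a b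

/-- The joints of the subdivided linkage: the vertices of the polyhedron and the dividing points. -/
def joints (P : Polyhedron) (C : Finset Space) : Set Space := {x | P.IsVertex x} ∪ C

/-- The linkage of the edges of the polyhedron, divided at the points of `C`: the bars join
consecutive joints on an edge, and their lengths are those in the polyhedron. -/
noncomputable def subdividedLinkage (P : Polyhedron) (C : Finset Space) :
    Linkage (P.joints C) where
  graph :=
    { Adj := fun x y => x ≠ y ∧
        (∃ a b, P.skeleton.Adj a b ∧ (x : Space) ∈ segment ℝ a b ∧ (y : Space) ∈ segment ℝ a b) ∧
        ∀ z ∈ P.joints C, z ∉ openSegment ℝ (x : Space) y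
      symm := ⟨fun x y h => ⟨h.1.symm,
        h.2.1.imp fun _ h' => h'.imp fun _ h'' => ⟨h''.1, h''.2.2, h''.2.1⟩,
        fun z hz => by rw [openSegment_symm]; exact h.2.2 z hz⟩⟩
      loopless := ⟨fun _ h => h.1 rfl⟩ }
  length x y := dist (x : Space) y
  length_comm _ _ := dist_comm _ _

/-- The number of times the edge `a b` is subdivided. -/
noncomputable def numSubdivisions (C : Finset Space) (a b : Space) : ℕ :=
  Set.ncard ((C : Set Space) ∩ openSegment ℝ a b)

variable {P : Polyhedron} {C : Finset Space}

/-- The motion turns the polyhedron inside-out: it leads from the polyhedron to its reflection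
through a plane. -/
def IsReversing (M : (P.subdividedLinkage C).Motion) : Prop :=
  (∀ x, M.state 0 x = x) ∧
    ∃ (H : AffineSubspace ℝ Space) (_ : Nonempty H), Module.finrank ℝ H.direction = 2 ∧
      ∀ x, M.state 1 x = EuclideanGeometry.reflection H (x : Space)

/-- The position at time `t` of the joints on the boundary of the face `i`.  The boundary of the
face is at that time the closed polygonal curve through them. -/
def faceJointsAt (M : (P.subdividedLinkage C).Motion) (i : Fin P.numFaces) (t : unitInterval) :
    Set Space :=
  M.state t '' {x | (x : Space) ∈ (P.face i).boundary}

/-- The motion takes the linkage through the face `i`: every joint passes at some time through the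
face.  The boundary of the face may itself bend during the motion and need not stay planar; as
the part of space that the face can span at time `t` we allow the whole convex hull of its boundary
at that time, which is the plane region of the face as long as that is rigid and convex. -/
def PassesThrough (M : (P.subdividedLinkage C).Motion) (i : Fin P.numFaces) : Prop :=
  ∀ x, ∃ t, M.state t x ∈ convexHull ℝ (faceJointsAt M i t)

end Polyhedron

/-! Let `u` be an endpoint of the edge and let `R` be the length of a path from `f` to `u` plus half
the perimeter of `f`. In every state the boundary joints of `f` lie in the ball of radius `R` about
`u`, hence so does their convex hull: each joint is at some time within `R` of `u`
(`exists_dist_state_le`). Let `d k` be the original distance from `u` of the `k`-th joint along the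
edge. When that joint is within `R` of `u`, its predecessor is at most `d (k-1)` from `u` and joined
to it by a bar of length `d k - d (k-1)`. So `d k ≤ 2 * d (k-1) + R`, whence `d k ≤ (2 ^ k - 1) * R`
(`dist_le_of_exists_dist_state_le`). With `n` subdivisions the far endpoint has `k = n + 1`; taking
logarithms bounds `n` from below. -/

/-! ### Segments and the count of joints inside them -/

section Segments

variable {E : Type*} [AddCommGroup E] [Module ℝ E]

theorem mem_openSegment_iff_sbtw {x y z : E} (h : x ≠ y) :
    z ∈ openSegment ℝ x y ↔ Sbtw ℝ x z y := by
  constructor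
  · intro hz
    refine ⟨mem_segment_iff_wbtw.1 (openSegment_subset_segment ℝ x y hz), ?_, ?_⟩
    · rintro rfl
      exact h (left_mem_openSegment_iff.1 hz)
    · rintro rfl
      exact h (right_mem_openSegment_iff.1 hz)
  · rintro ⟨hz, hx, hy⟩
    exact mem_openSegment_of_ne_left_right hx.symm hy.symm (mem_segment_iff_wbtw.2 hz)

theorem openSegment_subset_left {x y z : E} (h : Sbtw ℝ x z y) :
    openSegment ℝ x z ⊆ openSegment ℝ x y := by
  intro w hw
  rw [mem_openSegment_iff_sbtw h.left_ne] at hw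
  exact (mem_openSegment_iff_sbtw h.left_ne_right).2 (h.trans_left hw)

theorem openSegment_subset_right {x y z : E} (h : Sbtw ℝ x z y) :
    openSegment ℝ z y ⊆ openSegment ℝ x y := by
  rw [openSegment_symm ℝ z, openSegment_symm ℝ x]
  exact openSegment_subset_left h.symm

/-- Cutting at `z` loses at least `z` itself. This count is the measure for the inductions along an
edge. -/
theorem ncard_inter_openSegment_lt_left {J : Set E} (hJ : J.Finite) {x y z : E} (hz : z ∈ J)
    (h : Sbtw ℝ x z y) :
    (J ∩ openSegment ℝ x z).ncard < (J ∩ openSegment ℝ x y).ncard := by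
  refine Set.ncard_lt_ncard ?_ (hJ.inter_of_left _)
  refine ⟨Set.inter_subset_inter_right _ (openSegment_subset_left h), fun hs => ?_⟩
  have := (hs ⟨hz, (mem_openSegment_iff_sbtw h.left_ne_right).2 h⟩).2
  exact h.left_ne (right_mem_openSegment_iff.1 this)

theorem ncard_inter_openSegment_lt_right {J : Set E} (hJ : J.Finite) {x y z : E} (hz : z ∈ J)
    (h : Sbtw ℝ x z y) :
    (J ∩ openSegment ℝ z y).ncard < (J ∩ openSegment ℝ x y).ncard := by
  rw [openSegment_symm ℝ z, openSegment_symm ℝ x]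
  exact ncard_inter_openSegment_lt_left hJ hz h.symm

end Segments

open Fin.NatCast in
/-- On a closed polygonal curve of length `∑ k, d k`, two points are joined by two complementary
arcs, so that their distance is at most half of the length. -/
theorem two_mul_dist_le_sum {X : Type*} [PseudoMetricSpace X] {n : ℕ} [NeZero n] (v : Fin n → X)
    (d : Fin n → ℝ) (hv : ∀ k, dist (v k) (v (k + 1)) ≤ d k) (x : X) (j m : Fin n) (p q : ℝ)
    (hp : dist x (v j) ≤ p) (hq : dist x (v (j + 1)) ≤ q) (hpq : p + q = d j) :
    2 * dist x (v m) ≤ ∑ k, d k := by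
  -- The offset runs over `1..n`, not `0..n-1`: the two arcs go from `j + 1` to `j + M` and from `j
  -- + M` to `j + n = j`, so `m = j` must be given `M = n`.
  obtain ⟨M, hM1, hMn, hM⟩ : ∃ M : ℕ, 1 ≤ M ∧ M ≤ n ∧ j + (M : Fin n) = m := by
    by_cases h : m = j
    · exact ⟨n, NeZero.one_le, le_rfl, by simp [h]⟩
    · refine ⟨(m - j : Fin n).val, ?_, (m - j : Fin n).isLt.le, by simp⟩
      rw [Nat.one_le_iff_ne_zero]
      simpa [Fin.ext_iff, sub_eq_zero] using fun h0 => h (sub_eq_zero.1 (Fin.ext h0))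
  have hstep : ∀ k : ℕ, dist (v (j + (k : Fin n))) (v (j + ((k + 1 : ℕ) : Fin n))) ≤
      d (j + (k : Fin n)) := by
    intro k
    have := hv (j + (k : Fin n))
    rwa [add_assoc, ← Nat.cast_succ] at this
  have hsum : ∑ k, d k = ∑ k ∈ Finset.range n, d (j + (k : Fin n)) := by
    rw [← Fin.sum_univ_eq_sum_range (fun k => d (j + (k : Fin n))),
      ← Equiv.sum_comp (Equiv.addLeft j)]
    simp
  have h1 := dist_le_Ico_sum_of_dist_le hM1 (f := fun k : ℕ => v (j + (k : Fin n)))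
    (d := fun k : ℕ => d (j + (k : Fin n))) fun _ _ => hstep _
  have h2 := dist_le_Ico_sum_of_dist_le hMn (f := fun k : ℕ => v (j + (k : Fin n)))
    (d := fun k : ℕ => d (j + (k : Fin n))) fun _ _ => hstep _
  have hsplit := Finset.sum_Ico_consecutive (fun k : ℕ => d (j + (k : Fin n))) hM1 hMn
  have hfirst := Finset.sum_eq_sum_Ico_succ_bot (NeZero.pos n) (fun k : ℕ => d (j + (k : Fin n)))
  rw [hsum, Finset.range_eq_Ico, hfirst, ← hsplit]
  simp only [Nat.cast_one, hM, Nat.cast_zero, add_zero, Fin.natCast_self] at h1 h2 ⊢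
  have t1 := dist_triangle x (v (j + 1)) (v m)
  have t2 := dist_triangle x (v j) (v m)
  rw [dist_comm (v j)] at t2
  linarith

/-! ### Polygons: sides, corners and boundary -/

namespace PlanarPolygon

variable {F : PlanarPolygon}

instance : NeZero F.numSides := ⟨by have := F.three_le; omega⟩

theorem vertex_ne_next (j : Fin F.numSides) : F.poly j ≠ F.poly (finRotate _ j) := by
  intro h
  have h1 := F.injective h
  rw [finRotate_apply, left_eq_add] at h1
  have := congrArg Fin.val h1
  have h3 := F.three_le
  rw [Fin.val_one', Nat.mod_eq_of_lt (by omega)] at this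
  simp at this

theorem IsSide.symm {a b : Space} (h : F.IsSide a b) : F.IsSide b a :=
  h.imp fun _ hj => hj.symm

theorem IsSide.isVertex_left {a b : Space} (h : F.IsSide a b) : F.IsVertex a := by
  obtain ⟨j, h | h⟩ := h
  exacts [⟨_, h.1⟩, ⟨_, h.2⟩]

theorem IsSide.ne {a b : Space} (h : F.IsSide a b) : a ≠ b := by
  obtain ⟨j, ⟨rfl, rfl⟩ | ⟨rfl, rfl⟩⟩ := h
  exacts [vertex_ne_next j, (vertex_ne_next j).symm]

theorem isSide_next (j : Fin F.numSides) : F.IsSide (F.poly j) (F.poly (finRotate _ j)) :=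
  ⟨j, Or.inl ⟨rfl, rfl⟩⟩

theorem IsSide.segment_subset_boundary {a b : Space} (h : F.IsSide a b) :
    segment ℝ a b ⊆ F.boundary := by
  obtain ⟨j, ⟨rfl, rfl⟩ | ⟨rfl, rfl⟩⟩ := h
  · exact Set.subset_iUnion_of_subset j subset_rfl
  · rw [segment_symm]
    exact Set.subset_iUnion_of_subset j subset_rfl

theorem IsVertex.mem_boundary {x : Space} (h : F.IsVertex x) : x ∈ F.boundary := by
  obtain ⟨j, rfl⟩ := h
  exact (isSide_next j).segment_subset_boundary (left_mem_segment ℝ _ _)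

theorem boundary_subset_region : F.boundary ⊆ F.region := by
  intro x hx
  refine ⟨?_, ?_⟩
  · obtain ⟨j, hj⟩ := Set.mem_iUnion.1 hx
    exact (affineSpan ℝ (Set.range F.poly.vertices)).convex.segment_subset
      (subset_affineSpan ℝ _ ⟨j, rfl⟩) (subset_affineSpan ℝ _ ⟨_, rfl⟩) hj
  · rw [connectedComponentIn_eq_empty fun h => h.2 hx]
    exact Bornology.isBounded_empty

/-- Simplicity is applied to the given side and the side that starts at `x`: their common point `x`
has to be an end of the former. -/
theorem IsVertex.notMem_openSegment {a b x : Space} (hx : F.IsVertex x) (h : F.IsSide a b) :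
    x ∉ openSegment ℝ a b := by
  intro hm
  have hne := (mem_openSegment_iff_sbtw h.ne).1 hm
  have hseg := openSegment_subset_segment ℝ a b hm
  obtain ⟨k, rfl⟩ := hx
  obtain ⟨j, hj⟩ := h
  have hjk : j ≠ k := by
    rintro rfl
    rcases hj with hj | hj
    · exact hne.ne_left hj.1
    · exact hne.ne_right hj.1
  have hs : F.poly k ∈ segment ℝ (F.poly j) (F.poly (finRotate _ j)) := by
    rcases hj with ⟨rfl, rfl⟩ | ⟨rfl, rfl⟩
    · exact hseg
    · rwa [segment_symm]
  have := (F.simple j k hjk ⟨hs, left_mem_segment ℝ _ _⟩).1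
  have hend : F.poly k = a ∨ F.poly k = b := by
    rcases hj with ⟨rfl, rfl⟩ | ⟨rfl, rfl⟩
    · exact this
    · exact this.symm
  exact hend.elim hne.ne_left hne.ne_right

theorem finite_setOf_isVertex (F : PlanarPolygon) : {x | F.IsVertex x}.Finite :=
  Set.finite_range F.poly.vertices

end PlanarPolygon

/-! ### The skeleton, and distances that hold in every state -/

namespace Polyhedron

variable {P : Polyhedron} {C : Finset Space}

/-- Ensures that the joints strictly inside an edge are exactly the chosen subdivision points. -/
theorem notMem_openSegment_of_isVertex {a b x : Space} (hx : P.IsVertex x)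
    (h : P.skeleton.Adj a b) : x ∉ openSegment ℝ a b := by
  intro hm
  obtain ⟨-, i, hi⟩ := h
  obtain ⟨j, hj⟩ := hx
  have hxi : ¬ (P.face i).IsVertex x := fun h' => h'.notMem_openSegment hi hm
  have hij : i ≠ j := by
    rintro rfl
    exact hxi hj
  have hreg : x ∈ (P.face i).region ∩ (P.face j).region :=
    ⟨PlanarPolygon.boundary_subset_region
      (hi.segment_subset_boundary (openSegment_subset_segment ℝ a b hm)),
      PlanarPolygon.boundary_subset_region hj.mem_boundary⟩
  rcases P.inter_subset i j hij x hreg with h' | ⟨p, q, hip, hjp, hxs⟩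
  · exact hxi h'.1
  · have : x = p ∨ x = q := by
      by_contra! hne
      exact hj.notMem_openSegment hjp (mem_openSegment_of_ne_left_right hne.1.symm hne.2.symm hxs)
    rcases this with rfl | rfl
    · exact hxi hip.isVertex_left
    · exact hxi hip.symm.isVertex_left

theorem isVertex_of_adj {a b : Space} (h : P.skeleton.Adj a b) : P.IsVertex a :=
  h.2.imp fun _ hi => hi.isVertex_left

theorem finite_joints (P : Polyhedron) (C : Finset Space) : (P.joints C).Finite := by
  refine Set.Finite.union ?_ C.finite_toSet
  simp only [IsVertex, Set.ofPred_exists]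
  exact Set.finite_iUnion fun i => (P.face i).finite_setOf_isVertex

theorem joints_inter_openSegment {a b : Space} (h : P.skeleton.Adj a b) :
    P.joints C ∩ openSegment ℝ a b = ↑C ∩ openSegment ℝ a b := by
  ext x
  simp only [joints, Set.mem_inter_iff, Set.mem_union, Set.mem_ofPred_eq, SetLike.mem_coe]
  constructor
  · rintro ⟨hx | hx, hm⟩
    · exact (notMem_openSegment_of_isVertex hx h hm).elim
    · exact ⟨hx, hm⟩
  · exact fun hx => ⟨Or.inr hx.1, hx.2⟩

open Fin.NatCast in
theorem reachable_of_isVertex_face {i : Fin P.numFaces} {x y : Space}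
    (hx : (P.face i).IsVertex x) (hy : (P.face i).IsVertex y) : P.skeleton.Reachable x y := by
  have key : ∀ (j : Fin (P.face i).numSides) (k : ℕ), P.skeleton.Reachable ((P.face i).poly j)
      ((P.face i).poly (j + (k : Fin (P.face i).numSides))) := by
    intro j k
    induction k with
    | zero => simp
    | succ k ih =>
      refine ih.trans (SimpleGraph.Adj.reachable ⟨?_, i, ?_⟩)
      all_goals rw [Nat.cast_succ, ← add_assoc, ← finRotate_apply]
      · exact PlanarPolygon.vertex_ne_next _
      · exact PlanarPolygon.isSide_next _
  obtain ⟨j, rfl⟩ := hx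
  obtain ⟨k, rfl⟩ := hy
  simpa using key j (k - j : Fin _).val

/-- Makes the set of path lengths in `edgeFaceDist` nonempty, so that its `sInf` is a genuine
infimum. -/
theorem reachable_of_isVertex {x y : Space} (hx : P.IsVertex x) (hy : P.IsVertex y) :
    P.skeleton.Reachable x y := by
  obtain ⟨i, hi⟩ := hx
  obtain ⟨j, hj⟩ := hy
  have key : ∀ y, (P.face j).IsVertex y → P.skeleton.Reachable x y := by
    clear hj y
    induction P.connected i j with
    | refl => exact fun y hy => reachable_of_isVertex_face hi hy
    | tail _ h ih =>
      obtain ⟨a, b, hk, hl⟩ := h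
      exact fun y hy => (ih a hk.isVertex_left).trans
        (reachable_of_isVertex_face hl.isVertex_left hy)
  exact key y hj

/-- A chain of bars that starts out straight can only bring its ends closer: split at intermediate
joints down to single bars. -/
theorem dist_state_le {s : P.joints C → Space} (hs : (P.subdividedLinkage C).IsState s)
    {a b : Space} (h : P.skeleton.Adj a b) (x y : P.joints C) (hx : (x : Space) ∈ segment ℝ a b)
    (hy : (y : Space) ∈ segment ℝ a b) : dist (s x) (s y) ≤ dist (x : Space) y := by
  induction hN : (P.joints C ∩ openSegment ℝ (x : Space) y).ncard using Nat.strong_induction_on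
    generalizing x y with
  | _ N ih =>
  subst hN
  by_cases hxy : x = y
  · simp [hxy]
  by_cases hz : ∃ z ∈ P.joints C, z ∈ openSegment ℝ (x : Space) y
  · obtain ⟨z, hzJ, hz⟩ := hz
    have hzs := openSegment_subset_segment ℝ _ _ hz
    have hzab := (convex_segment a b).segment_subset hx hy hzs
    have hsb := (mem_openSegment_iff_sbtw fun h' => hxy (Subtype.ext h')).1 hz
    have h1 := ih _ (ncard_inter_openSegment_lt_left (P.finite_joints C) hzJ hsb)
      x ⟨z, hzJ⟩ hx hzab rfl
    have h2 := ih _ (ncard_inter_openSegment_lt_right (P.finite_joints C) hzJ hsb)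
      ⟨z, hzJ⟩ y hzab hy rfl
    rw [← dist_add_dist_of_mem_segment hzs]
    exact (dist_triangle _ _ _).trans (add_le_add h1 h2)
  · push Not at hz
    exact (hs x y ⟨hxy, ⟨a, b, h, hx, hy⟩, hz⟩).le

theorem dist_state_le_pathLength {s : P.joints C → Space}
    (hs : (P.subdividedLinkage C).IsState s) {x y : Space} (p : P.skeleton.Walk x y)
    (hx : x ∈ P.joints C) (hy : y ∈ P.joints C) :
    dist (s ⟨x, hx⟩) (s ⟨y, hy⟩) ≤ P.pathLength p := by
  induction p with
  | nil => simp [pathLength]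
  | cons h p ih =>
    have hv : P.IsVertex _ := isVertex_of_adj h.symm
    have h1 := dist_state_le hs h ⟨_, hx⟩ ⟨_, Or.inl hv⟩ (left_mem_segment ℝ _ _)
      (right_mem_segment ℝ _ _)
    have h2 := ih (Or.inl hv) hy
    refine (dist_triangle _ _ _).trans ((add_le_add h1 h2).trans_eq ?_)
    simp [pathLength]

theorem dist_state_face_le {s : P.joints C → Space} (hs : (P.subdividedLinkage C).IsState s)
    {i : Fin P.numFaces} (x w : P.joints C) (hx : (x : Space) ∈ (P.face i).boundary)
    (hw : (P.face i).IsVertex w) : dist (s x) (s w) ≤ (P.face i).circumference / 2 := by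
  have hJ : ∀ k, (P.face i).poly k ∈ P.joints C := fun k => Or.inl ⟨i, k, rfl⟩
  have hadj : ∀ k, P.skeleton.Adj ((P.face i).poly k) ((P.face i).poly (k + 1)) := by
    intro k
    rw [← finRotate_apply]
    exact ⟨PlanarPolygon.vertex_ne_next k, i, PlanarPolygon.isSide_next k⟩
  obtain ⟨w, hwJ⟩ := w
  obtain ⟨m, rfl⟩ := hw
  obtain ⟨j, hj⟩ := Set.mem_iUnion.1 hx
  rw [finRotate_apply] at hj
  have := two_mul_dist_le_sum (fun k => s ⟨_, hJ k⟩)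
    (fun k => dist ((P.face i).poly k) ((P.face i).poly (finRotate _ k)))
    (fun k => by
      rw [finRotate_apply]
      exact dist_state_le hs (hadj k) _ _ (left_mem_segment ℝ _ _) (right_mem_segment ℝ _ _))
    (s x) j m _ _
    (dist_state_le hs (hadj j) _ _ hj (left_mem_segment ℝ _ _))
    (dist_state_le hs (hadj j) _ _ hj (right_mem_segment ℝ _ _))
    (by rw [finRotate_apply, dist_comm (x : Space), dist_add_dist_of_mem_segment hj])
  rw [PlanarPolygon.circumference]
  linarith

end Polyhedron

/-! ### The doubling estimate along an edge -/

namespace Polyhedron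

variable {P : Polyhedron} {C : Finset Space}

/-- If the face can be reached from the endpoint `u` by a path, then each joint of the edge `u v`
comes within a bounded distance of `u`. -/
theorem exists_dist_state_le {i : Fin P.numFaces} {M : (P.subdividedLinkage C).Motion}
    (hM : PassesThrough M i) {u w : Space} (hu : P.IsVertex u) (hw : (P.face i).IsVertex w)
    (p : P.skeleton.Walk w u) (x : P.joints C) :
    ∃ t, dist (M.state t x) (M.state t ⟨u, Or.inl hu⟩) ≤
      P.pathLength p + (P.face i).circumference / 2 := by
  obtain ⟨t, ht⟩ := hM x
  refine ⟨t, ?_⟩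
  have hsub : faceJointsAt M i t ⊆ Metric.closedBall (M.state t ⟨u, Or.inl hu⟩)
      (P.pathLength p + (P.face i).circumference / 2) := by
    rintro _ ⟨y, hy, rfl⟩
    have h1 := dist_state_face_le (M.isState t) y ⟨w, Or.inl ⟨i, hw⟩⟩ hy hw
    have h2 := dist_state_le_pathLength (M.isState t) p (Or.inl ⟨i, hw⟩) (Or.inl hu)
    rw [Metric.mem_closedBall]
    linarith [dist_triangle (M.state t y) (M.state t ⟨w, Or.inl ⟨i, hw⟩⟩)
      (M.state t ⟨u, Or.inl hu⟩)]
  exact convexHull_min hsub (convex_closedBall _ _) ht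

/-- If each joint of the edge `u v` comes within distance `R` of `u` during the motion, then the
distances of consecutive joints from `u` at most double, up to the addition of `R`. -/
theorem dist_le_of_exists_dist_state_le {M : (P.subdividedLinkage C).Motion} {R : ℝ} {v : Space}
    (u : P.joints C) (h : P.skeleton.Adj u v)
    (hR : ∀ x, ∃ t, dist (M.state t x) (M.state t u) ≤ R) (x : P.joints C)
    (hx : (x : Space) ∈ segment ℝ (u : Space) v) :
    dist (u : Space) x ≤
      (2 ^ ((P.joints C ∩ openSegment ℝ (u : Space) x).ncard + 1) - 1) * R := by
  have hR0 : 0 ≤ R := (hR u).elim fun _ h => dist_nonneg.trans h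
  induction hN : (P.joints C ∩ openSegment ℝ (u : Space) x).ncard using Nat.strong_induction_on
    generalizing x with
  | _ N ih =>
  subst hN
  have hpow : ∀ k : ℕ, (1 : ℝ) ≤ 2 ^ k := fun k => one_le_pow₀ one_le_two
  by_cases hux : u = x
  · rw [hux, dist_self]
    exact mul_nonneg (sub_nonneg.2 (hpow _)) hR0
  have hux' : (u : Space) ≠ x := fun h' => hux (Subtype.ext h')
  obtain ⟨t, ht⟩ := hR x
  have hu := left_mem_segment ℝ (u : Space) v
  by_cases hne : (P.joints C ∩ openSegment ℝ (u : Space) x).Nonempty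
  -- The joint farthest from `u` before `x` is the predecessor of `x`, so `z` and `x` are joined by
  -- a bar.
  · obtain ⟨z, ⟨hzJ, hz⟩, hmax⟩ := Set.exists_max_image _ (fun z => dist (u : Space) z)
      ((P.finite_joints C).inter_of_left _) hne
    have hsb := (mem_openSegment_iff_sbtw hux').1 hz
    have hzs := openSegment_subset_segment ℝ _ _ hz
    have hzv := (convex_segment (u : Space) v).segment_subset hu hx hzs
    have hlt := ncard_inter_openSegment_lt_left (P.finite_joints C) hzJ hsb
    have h1 := ih _ hlt ⟨z, hzJ⟩ hzv rfl
    have h2 := M.isState t ⟨z, hzJ⟩ x ⟨fun h' => hsb.ne_right (congrArg Subtype.val h'),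
      ⟨u, v, h, hzv, hx⟩, fun y hyJ hy => by
        have hy' := (mem_openSegment_iff_sbtw hsb.ne_right).1 hy
        have huy := hsb.wbtw.trans_right_left hy'.wbtw
        have hle := hmax y ⟨hyJ, openSegment_subset_right hsb hy⟩
        have hpos := dist_pos.2 hy'.left_ne
        linarith [huy.dist_add_dist]⟩
    have h3 := dist_state_le (M.isState t) h u ⟨z, hzJ⟩ hu hzv
    have h5 := dist_add_dist_of_mem_segment hzs
    change _ = dist z (x : Space) at h2
    have hmono : (2 : ℝ) ^ ((P.joints C ∩ openSegment ℝ (u : Space) z).ncard + 1) ≤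
        2 ^ (P.joints C ∩ openSegment ℝ (u : Space) x).ncard :=
      pow_le_pow_right₀ one_le_two hlt
    have h6 := mul_le_mul_of_nonneg_right hmono hR0
    rw [pow_succ (2 : ℝ) (P.joints C ∩ openSegment ℝ (u : Space) x).ncard]
    have h4 := dist_triangle (M.state t ⟨z, hzJ⟩) (M.state t u) (M.state t x)
    rw [dist_comm (M.state t ⟨z, hzJ⟩) (M.state t u), dist_comm (M.state t u) (M.state t x)] at h4
    linarith
  · have hemp := Set.not_nonempty_iff_eq_empty.1 hne
    have h2 := M.isState t u x ⟨hux, ⟨u, v, h, hu, hx⟩, fun y hyJ hy => hne ⟨y, hyJ, hy⟩⟩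
    change _ = dist (u : Space) (x : Space) at h2
    rw [hemp, Set.ncard_empty, ← h2, dist_comm, zero_add, pow_one]
    linarith

theorem dist_le_of_passesThrough {i : Fin P.numFaces} {M : (P.subdividedLinkage C).Motion}
    (hM : PassesThrough M i) {u v w : Space} (h : P.skeleton.Adj u v)
    (hw : (P.face i).IsVertex w) (p : P.skeleton.Walk w u) :
    dist u v ≤ (2 ^ (numSubdivisions C u v + 1) - 1) *
      (P.pathLength p + (P.face i).circumference / 2) := by
  have := dist_le_of_exists_dist_state_le ⟨u, Or.inl (isVertex_of_adj h)⟩ h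
    (exists_dist_state_le hM (isVertex_of_adj h) hw p) ⟨v, Or.inl (isVertex_of_adj h.symm)⟩
    (right_mem_segment ℝ _ _)
  rwa [joints_inter_openSegment h] at this

theorem numSubdivisions_comm (C : Finset Space) (a b : Space) :
    numSubdivisions C a b = numSubdivisions C b a := by
  rw [numSubdivisions, numSubdivisions, openSegment_symm]

/-- The length of an edge is bounded in terms of the number of its subdivisions and its distance
from the face that the polyhedron is turned through. -/
theorem dist_le_edgeFaceDist {i : Fin P.numFaces} {M : (P.subdividedLinkage C).Motion}
    (hM : PassesThrough M i) {a b : Space} (h : P.skeleton.Adj a b) :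
    dist a b ≤ (2 ^ (numSubdivisions C a b + 1) - 1) *
      (P.edgeFaceDist a b i + (P.face i).circumference / 2) := by
  -- Dividing by this positive factor isolates the infimum, leaving a lower bound to check for each
  -- path.
  have hK : (0 : ℝ) < 2 ^ (numSubdivisions C a b + 1) - 1 :=
    sub_pos.2 (one_lt_pow₀ one_lt_two (Nat.succ_ne_zero _))
  rw [← div_le_iff₀' hK, ← sub_le_iff_le_add]
  refine le_csInf ?_ ?_
  · have hw : (P.face i).IsVertex ((P.face i).poly 0) := ⟨0, rfl⟩
    obtain ⟨p⟩ := reachable_of_isVertex ⟨i, hw⟩ (isVertex_of_adj h)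
    exact ⟨_, _, _, hw, Or.inl rfl, p, rfl⟩
  · rintro _ ⟨w, u, hw, rfl | rfl, p, rfl⟩ <;> rw [sub_le_iff_le_add, div_le_iff₀' hK]
    · exact dist_le_of_passesThrough hM h hw p
    · rw [dist_comm, numSubdivisions_comm]
      exact dist_le_of_passesThrough hM h.symm hw p

end Polyhedron

/-! ### Passing to logarithms -/

theorem mainTheorem4 :
    ∃ c : ℝ, 0 < c ∧
      ∀ (P : Polyhedron) (f : Fin P.numFaces) (C : Finset Space), P.IsSubdivision C →
        ∀ M : (P.subdividedLinkage C).Motion,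
          Polyhedron.IsReversing M → Polyhedron.PassesThrough M f →
            ∀ a b : Space, P.skeleton.Adj a b →
              c * Real.log (dist a b / (P.edgeFaceDist a b f + (P.face f).circumference / 2)) ≤
                Polyhedron.numSubdivisions C a b := by
  have hlog : 0 < Real.log 4 := Real.log_pos (by norm_num)
  refine ⟨(Real.log 4)⁻¹, inv_pos.2 hlog, fun P f C _ M _ hM a b h => ?_⟩
  have hd : 0 < dist a b := dist_pos.2 h.1
  have hle := Polyhedron.dist_le_edgeFaceDist hM h
  set n := Polyhedron.numSubdivisions C a b
  set R := P.edgeFaceDist a b f + (P.face f).circumference / 2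
  have hK : (0 : ℝ) < 2 ^ (n + 1) - 1 :=
    sub_pos.2 (one_lt_pow₀ one_lt_two (Nat.succ_ne_zero _))
  have hR : 0 < R := pos_of_mul_pos_right (hd.trans_le hle) hK.le
  -- This is `(2 ^ n - 1) ^ 2 ≥ 0`. Base 4 absorbs the extra factor 2, so no additive constant
  -- survives the logarithm; hence `c = 1 / log 4`.
  have hpow : (2 : ℝ) ^ (n + 1) - 1 ≤ 4 ^ n := by
    have : (4 : ℝ) ^ n = (2 ^ n) ^ 2 := by rw [← pow_mul, mul_comm, pow_mul]; norm_num
    rw [this, pow_succ]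
    linarith [sq_nonneg ((2 : ℝ) ^ n - 1)]
  have hratio : dist a b / R ≤ 4 ^ n := ((div_le_iff₀ hR).2 hle).trans hpow
  rw [inv_mul_le_iff₀ hlog, mul_comm, ← Real.log_pow]
  exact Real.log_le_log (div_pos hd hR) hratio
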